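/- Let $d\ge 1$ and let $X$ be a polynomial hypergroup in $d$ variables associated with the family of polynomials $\{Q_x : x\in X\}\subset\mathbb{C}[z_1,\dots,z_d]$. That is, $X$ is a commutative hypergroup with identity $o$, involution $x\mapsto \check{x}$ and convolution $*$ such that: - for every $n\ge 0$ the family of those $Q_x$ that have degree at most $n$ is a basis of the space of polynomials of degree at most $n$; - $Q_x(1,\dots,1)=1$ for all $x$; - there is a probability measure $\pi$ on $\mathbb{C}^d$ with $Q_{\check{x}}(z)=\overline{Q_x(z)}$ for all $x$ and all $z\in\operatorname{supp}\pi$, and with $\int Q_xQ_yQ_w\,d\pi\ge 0$ for all $x,y,w$; - $\delta_x*\delta_y=\sum_{w} c(x,y,w)\,\delta_w$ for all $x,y$, where the $c(x,y,w)$ are the coefficients in $Q_xQ_y=\sum_w c(x,y,w)\,Q_w$. A variety is a linear space of continuous functions $X\to\mathbb{C}$ that is closed under uniform convergence on compact sets and under all translations $f\mapsto f(\cdot * y)$, $y\in X$, where $f(x*y)=\int_X f\,d(\delta_x*\delta_y)$. A continuous function $f:X\to\mathbb{C}$ is an exponential polynomial if the smallest variety $\tau(f)$ containing it is finite dimensional.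 It is an exponential monomial if moreover $\tau(f)$ is not the sum of two proper subvarieties. For $P=\sum_\alpha a_\alpha\xi^\alpha\in\mathbb{C}[\xi_1,\dots,\xi_d]$ write $P(\partial)=\sum_\alpha a_\alpha\,\partial_1^{\alpha_1}\cdots\partial_d^{\alpha_d}$. Then: 1. Every exponential monomial on $X$ has the form $x\mapsto [P(\partial)Q_x](\lambda)$ with some complex polynomial $P$ in $d$ variables and some $\lambda\in\mathbb{C}^d$. 2. Every exponential polynomial on $X$ has the form $x\mapsto \sum_{\lambda\in S}[P_\lambda(\partial)Q_x](\lambda)$ with some finite set $S\subset\mathbb{C}^d$ and complex polynomials $P_\lambda$ $(\lambda\in S)$ in $d$ variables. -/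

import Mathlib

open MeasureTheory Topology Filter
open scoped BoundedContinuousFunction NNReal ENNReal ComplexOrder

noncomputable section

/-- A commutative hypergroup structure on a locally compact Hausdorff space `X`, given by the
convolutions `δ_x * δ_y` of point masses (which determine the convolution of all bounded
measures), the identity and the involution. -/
structure CommHypergroup (X : Type*) [TopologicalSpace X] [T2Space X] [LocallyCompactSpace X]
    [MeasurableSpace X] [BorelSpace X] where
  /-- the convolution `δ_x * δ_y`, a probability measure -/
  conv : X → X → ProbabilityMeasure X
  /-- the identity `o` -/
  one : X
  /-- the involution -/
  inv : X → X
  regular_conv : ∀ x y, (conv x y : Measure X).Regular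
  isCompact_support : ∀ x y, IsCompact (conv x y : Measure X).support
  /-- weak continuity of the convolution -/
  continuous_conv : Continuous fun p : X × X => conv p.1 p.2
  /-- Continuity of `(x, y) ↦ supp (δ_x * δ_y)` in the Michael topology on the nonempty compact
  sets; the sets `{K | K ⊆ U}` and `{K | K ∩ U ≠ ∅}`, `U` open, form a subbasis of it. -/
  isOpen_support_subset : ∀ U : Set X, IsOpen U →
    IsOpen {p : X × X | (conv p.1 p.2 : Measure X).support ⊆ U}
  isOpen_support_inter : ∀ U : Set X, IsOpen U →
    IsOpen {p : X × X | ((conv p.1 p.2 : Measure X).support ∩ U).Nonempty}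
  /-- `(δ_x * δ_y) * δ_z = δ_x * (δ_y * δ_z)`, tested on bounded continuous functions -/
  conv_assoc : ∀ (x y z : X) (f : X →ᵇ ℂ),
    ∫ t, (∫ s, f s ∂(conv t z : Measure X)) ∂(conv x y : Measure X) =
      ∫ t, (∫ s, f s ∂(conv x t : Measure X)) ∂(conv y z : Measure X)
  conv_comm : ∀ x y, conv x y = conv y x
  one_conv : ∀ x, (conv one x : Measure X) = Measure.dirac x
  continuous_inv : Continuous inv
  inv_inv : ∀ x, inv (inv x) = x
  /-- the involution reverses convolution: `(δ_x * δ_y)ˇ = δ_yˇ * δ_xˇ` -/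
  map_inv_conv : ∀ x y,
    (conv x y : Measure X).map inv = (conv (inv y) (inv x) : Measure X)
  one_mem_support_iff : ∀ x y, one ∈ (conv x y : Measure X).support ↔ y = inv x

namespace CommHypergroup

variable {X : Type*} [TopologicalSpace X] [T2Space X] [LocallyCompactSpace X]
  [MeasurableSpace X] [BorelSpace X]

/-- Translates of continuous functions are continuous. -/
theorem continuous_translate (H : CommHypergroup X) (y : X) (f : C(X, ℂ)) :
    Continuous fun x => ∫ t, f t ∂(H.conv x y : Measure X) := by
  rw [continuous_iff_continuousAt]
  intro x₀
  obtain ⟨K, hK, hsub⟩ := exists_compact_superset (H.isCompact_support x₀ y)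
  obtain ⟨φ, hφ1, -, hφc, -⟩ := exists_continuous_one_zero_of_isCompact hK isClosed_empty
    (Set.disjoint_empty K)
  have hgc : Continuous fun t => (φ t : ℂ) * f t := by fun_prop
  have hgs : HasCompactSupport fun t => (φ t : ℂ) * f t := by
    have : HasCompactSupport fun t => (φ t : ℂ) := hφc.comp_left (g := fun r : ℝ => (r : ℂ)) rfl
    exact this.mul_right
  obtain ⟨C, hC⟩ := hgs.exists_bound_of_continuous hgc
  let g : X →ᵇ ℂ := BoundedContinuousFunction.ofNormedAddCommGroup _ hgc C hC
  have hcont : Continuous fun x => H.conv x y := H.continuous_conv.comp (by fun_prop :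
    Continuous fun x : X => (x, y))
  have hlim := (ProbabilityMeasure.tendsto_iff_forall_integral_rclike_tendsto ℂ).1
    (hcont.tendsto x₀) g
  have key : ∀ x, (H.conv x y : Measure X).support ⊆ interior K →
      ∫ t, g t ∂(H.conv x y : Measure X) = ∫ t, f t ∂(H.conv x y : Measure X) := by
    intro x hx
    have := H.regular_conv x y
    apply integral_congr_ae
    filter_upwards [Measure.support_mem_ae_of_regular (μ := (H.conv x y : Measure X))] with t ht
    have : φ t = 1 := hφ1 (interior_subset (hx ht))
    change (φ t : ℂ) * f t = f t
    simp [this]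
  have hev : ∀ᶠ x in 𝓝 x₀, (H.conv x y : Measure X).support ⊆ interior K :=
    ((H.isOpen_support_subset _ isOpen_interior).preimage (by fun_prop :
      Continuous fun x : X => (x, y))).mem_nhds hsub
  rw [ContinuousAt, ← key x₀ hsub]
  exact hlim.congr' (hev.mono key)

/-- The translate `x ↦ f(x * y)` of `f` by `y`. -/
def translate (H : CommHypergroup X) (y : X) (f : C(X, ℂ)) : C(X, ℂ) :=
  ⟨fun x => ∫ t, f t ∂(H.conv x y : Measure X), H.continuous_translate y f⟩

/-- A variety: a translation invariant linear subspace of `C(X, ℂ)`, closed for uniform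
convergence on compact sets (the compact-open topology of `C(X, ℂ)`). -/
def IsVariety (H : CommHypergroup X) (V : Submodule ℂ C(X, ℂ)) : Prop :=
  IsClosed (V : Set C(X, ℂ)) ∧ ∀ f ∈ V, ∀ y, H.translate y f ∈ V

/-- The variety of `f`: the intersection of all varieties containing `f`. -/
def varietyOf (H : CommHypergroup X) (f : C(X, ℂ)) : Submodule ℂ C(X, ℂ) :=
  sInf {V | H.IsVariety V ∧ f ∈ V}

/-- `f` is an exponential polynomial if its variety is finite dimensional. -/
def IsExponentialPolynomial (H : CommHypergroup X) (f : C(X, ℂ)) : Prop :=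
  FiniteDimensional ℂ (H.varietyOf f)

/-- An exponential polynomial is an exponential monomial if its variety is indecomposable: it is
not the sum of two proper subvarieties. -/
def IsExponentialMonomial (H : CommHypergroup X) (f : C(X, ℂ)) : Prop :=
  H.IsExponentialPolynomial f ∧
    ¬ ∃ V W : Submodule ℂ C(X, ℂ), H.IsVariety V ∧ H.IsVariety W ∧
      V < H.varietyOf f ∧ W < H.varietyOf f ∧ V ⊔ W = H.varietyOf f

/-- `X` is the polynomial hypergroup in `d` variables associated with the family `(Q_x)`. -/
structure IsPolynomialHypergroup (H : CommHypergroup X) {d : ℕ}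
    (Q : X → MvPolynomial (Fin d) ℂ) : Prop where
  /-- the `Q_x` of degree at most `n` are linearly independent -/
  linearIndependent : ∀ n : ℕ,
    LinearIndependent ℂ fun x : {x : X // (Q x).totalDegree ≤ n} => Q x
  /-- and they span the space of all polynomials of degree at most `n` -/
  span_eq : ∀ n : ℕ, Submodule.span ℂ (Q '' {x | (Q x).totalDegree ≤ n}) =
    MvPolynomial.restrictTotalDegree (Fin d) ℂ n
  eval_one : ∀ x, MvPolynomial.eval (fun _ => 1) (Q x) = 1
  exists_measure : ∃ π : Measure (Fin d → ℂ), IsProbabilityMeasure π ∧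
    (∀ x, ∀ z ∈ π.support,
      MvPolynomial.eval z (Q (H.inv x)) = starRingEnd ℂ (MvPolynomial.eval z (Q x))) ∧
    ∀ x y w, Integrable (fun z => MvPolynomial.eval z (Q x * Q y * Q w)) π ∧
      0 ≤ ∫ z, MvPolynomial.eval z (Q x * Q y * Q w) ∂π
  /-- The coefficients `c` of `Q_x Q_y = ∑ c(w) Q_w` (unique, as the `Q_w` form a basis) are those
  of `δ_x * δ_y = ∑ c(w) δ_w`. -/
  linearization : ∀ x y, ∃ c : X →₀ ℝ≥0,
    Q x * Q y = c.sum (fun w a => ((a : ℝ) : ℂ) • Q w) ∧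
    (H.conv x y : Measure X) = c.sum (fun w a => a • Measure.dirac w)

end CommHypergroup

/-- `∂^α = ∂_1^{α_1} ⋯ ∂_d^{α_d}` on `ℂ[z_1, …, z_d]`. -/
def partialPow {d : ℕ} (α : Fin d →₀ ℕ) : Module.End ℂ (MvPolynomial (Fin d) ℂ) :=
  (List.ofFn fun i : Fin d =>
    ((MvPolynomial.pderiv i).toLinearMap : Module.End ℂ (MvPolynomial (Fin d) ℂ)) ^ α i).prod

/-- `P(∂) = ∑ a_α ∂^α` for `P = ∑ a_α ξ^α`. -/
def polyDiff {d : ℕ} (P : MvPolynomial (Fin d) ℂ) : Module.End ℂ (MvPolynomial (Fin d) ℂ) :=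
  ∑ α ∈ P.support, P.coeff α • partialPow α

end

/-! Since the `Q x` form a basis of `ℂ[z]`, a function `f` on `X` is the same as its values under a
linear functional `Q x ↦ f x`, and the linearization formula turns translation by `y` into
multiplication by `Q y` (`functional_translate`). A finite dimensional variety thus becomes a finite
dimensional `ℂ[z]`-submodule of the dual of `ℂ[z]`. Multiplications by the coordinates commute, so
over `ℂ` such a submodule is the sum of its joint generalized eigenspaces
(`le_iSup_inf_localFunctionals`). A functional in the one at `l` sees only finitely many Taylor
coefficients at `l`, so it is `p ↦ [P(∂)p](l)` (`exists_eq_eval_polyDiff`). This gives the second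
claim. For the first, each local part is itself a variety, so an indecomposable variety lies at a
single `l`. -/

namespace MvPolynomial

/-! ### Taylor expansion at a point: derivatives of shifted monomials -/

variable {d : ℕ}

/-- The monomial `(z - l)^β` centred at `l`. -/
noncomputable def shiftedMonomial (l : Fin d → ℂ) (β : Fin d →₀ ℕ) : MvPolynomial (Fin d) ℂ :=
  ∏ i, (X i - C (l i)) ^ β i

theorem pderiv_shiftedMonomial (l : Fin d → ℂ) (β : Fin d →₀ ℕ) (i : Fin d) :
    pderiv i (shiftedMonomial l β) =
      (β i : ℂ) • shiftedMonomial l (β - Finsupp.single i 1) := by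
  classical
  have hrest : ∀ γ : Fin d →₀ ℕ, shiftedMonomial l γ =
      (X i - C (l i)) ^ γ i * ∏ j ∈ Finset.univ.erase i, (X j - C (l j)) ^ γ j := fun γ =>
    (Finset.mul_prod_erase _ _ (Finset.mem_univ i)).symm
  have hconst : ∀ s : Finset (Fin d), i ∉ s →
      pderiv i (∏ j ∈ s, (X j - C (l j)) ^ β j) = 0 := by
    intro s
    induction s using Finset.induction_on with
    | empty => simp
    | insert j s hj ih =>
      intro hi
      rw [Finset.mem_insert, not_or] at hi
      rw [Finset.prod_insert hj, pderiv_mul, ih hi.2, pderiv_pow, map_sub, pderiv_C,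
        pderiv_X_of_ne (Ne.symm hi.1)]
      simp
  have hsame : ∏ j ∈ Finset.univ.erase i, (X j - C (l j)) ^ (β - Finsupp.single i 1 : Fin d →₀ ℕ) j =
      ∏ j ∈ Finset.univ.erase i, (X j - C (l j)) ^ β j := by
    refine Finset.prod_congr rfl fun j hj => ?_
    have : i ≠ j := (Finset.ne_of_mem_erase hj).symm
    simp [this]
  rw [hrest β, hrest (β - _), hsame, pderiv_mul, hconst _ (Finset.notMem_erase _ _), pderiv_pow,
    map_sub, pderiv_C, pderiv_X_self, smul_eq_C_mul]
  simp
  ring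

theorem pderiv_pow_shiftedMonomial (l : Fin d → ℂ) (β : Fin d →₀ ℕ) (i : Fin d) (k : ℕ) :
    (((pderiv i).toLinearMap : Module.End ℂ (MvPolynomial (Fin d) ℂ)) ^ k)
        (shiftedMonomial l β) =
      ((β i).descFactorial k : ℂ) • shiftedMonomial l (β - Finsupp.single i k) := by
  induction k with
  | zero => simp
  | succ k ih =>
    rw [pow_succ', Module.End.mul_apply, ih, map_smul, Derivation.coeFn_coe, pderiv_shiftedMonomial, smul_smul, tsub_tsub, ← Finsupp.single_add,
      Nat.descFactorial_succ]
    simp [mul_comm]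

/-- `partialPow` is an ordered product, hence the induction over lists. As no index repeats, the
exponent at `i` is still `β i` when `∂_i` acts. -/
theorem prod_map_pderiv_pow_shiftedMonomial (l : Fin d → ℂ) (α β : Fin d →₀ ℕ)
    (L : List (Fin d)) (hL : L.Nodup) :
    (L.map fun i => ((pderiv i).toLinearMap : Module.End ℂ (MvPolynomial (Fin d) ℂ)) ^ α i).prod
        (shiftedMonomial l β) =
      ((L.map fun i => (β i).descFactorial (α i)).prod : ℂ) •
        shiftedMonomial l (β - (L.map fun i => Finsupp.single i (α i)).sum) := by
  induction L with
  | nil => simp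
  | cons i L ih =>
    rw [List.nodup_cons] at hL
    have hi : (L.map fun j => Finsupp.single j (α j)).sum i = 0 := by
      rw [← Finsupp.applyAddHom_apply, map_list_sum, List.map_map]
      refine List.sum_eq_zero fun n hn => ?_
      obtain ⟨j, hj, rfl⟩ := List.mem_map.1 hn
      have : j ≠ i := fun h => hL.1 (h ▸ hj)
      simp [this]
    rw [List.map_cons, List.prod_cons, Module.End.mul_apply, ih hL.2, map_smul,
      pderiv_pow_shiftedMonomial, smul_smul, tsub_tsub, Finsupp.tsub_apply, hi]
    simp [mul_comm, add_comm]

theorem partialPow_shiftedMonomial (l : Fin d → ℂ) (α β : Fin d →₀ ℕ) :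
    partialPow α (shiftedMonomial l β) =
      ((∏ i, (β i).descFactorial (α i) : ℕ) : ℂ) • shiftedMonomial l (β - α) := by
  have h := prod_map_pderiv_pow_shiftedMonomial l α β _ (List.nodup_finRange d)
  rw [← List.ofFn_eq_map, ← List.ofFn_eq_map, ← List.ofFn_eq_map, List.prod_ofFn,
    List.sum_ofFn, Finsupp.univ_sum_single] at h
  exact_mod_cast h

theorem eval_shiftedMonomial (l : Fin d → ℂ) (β : Fin d →₀ ℕ) :
    eval l (shiftedMonomial l β) = if β = 0 then 1 else 0 := by
  split_ifs with h
  · simp [h, shiftedMonomial]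
  · obtain ⟨i, hi⟩ := Finsupp.ne_iff.1 h
    rw [shiftedMonomial, map_prod]
    refine Finset.prod_eq_zero (Finset.mem_univ i) ?_
    simpa using hi

/-- Up to the factor `α!`, the functionals `p ↦ (∂^α p)(l)` are dual to the basis of shifted
monomials. -/
theorem eval_partialPow_shiftedMonomial (l : Fin d → ℂ) (α β : Fin d →₀ ℕ) :
    eval l (partialPow α (shiftedMonomial l β)) =
      if β = α then ((∏ i, (α i).factorial : ℕ) : ℂ) else 0 := by
  rw [partialPow_shiftedMonomial, smul_eval, eval_shiftedMonomial]
  split_ifs with h1 h2 h2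
  · simp [h2, Nat.descFactorial_self]
  -- Truncated `β - α = 0` only says `β ≤ α`; where the inequality is strict, the falling factorial
  -- vanishes.
  · obtain ⟨i, hi⟩ := Finsupp.ne_iff.1 h2
    have hle : β i ≤ α i := (tsub_eq_zero_iff_le.1 h1) i
    rw [mul_one, Nat.cast_eq_zero]
    exact Finset.prod_eq_zero (Finset.mem_univ i)
      (Nat.descFactorial_eq_zero_iff_lt.2 (lt_of_le_of_ne hle hi))
  · simp [h2] at h1
  · simp

theorem span_range_shiftedMonomial (l : Fin d → ℂ) :
    Submodule.span ℂ (Set.range (shiftedMonomial l)) = ⊤ := by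
  let τ : MvPolynomial (Fin d) ℂ →ₐ[ℂ] MvPolynomial (Fin d) ℂ := aeval fun i => X i - C (l i)
  let σ : MvPolynomial (Fin d) ℂ →ₐ[ℂ] MvPolynomial (Fin d) ℂ := aeval fun i => X i + C (l i)
  -- The substitution `z ↦ z - l` is onto and carries monomials to shifted monomials.
  have hτσ : τ.comp σ = AlgHom.id ℂ _ := by
    ext i : 1
    simp [τ, σ, ← algebraMap_eq]
  have hτ : ∀ p, τ p ∈ Submodule.span ℂ (Set.range (shiftedMonomial l)) := by
    intro p
    rw [p.as_sum, map_sum]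
    refine Submodule.sum_mem _ fun β _ => ?_
    have : τ (monomial β (p.coeff β)) = p.coeff β • shiftedMonomial l β := by
      rw [aeval_monomial, Finsupp.prod_fintype _ _ (by simp), algebraMap_eq, ← smul_eq_C_mul]
      rfl
    rw [this]
    exact Submodule.smul_mem _ _ (Submodule.subset_span ⟨β, rfl⟩)
  refine eq_top_iff.2 fun p _ => ?_
  have := hτ (σ p)
  rwa [← AlgHom.comp_apply, hτσ] at this

theorem polyDiff_sum_monomial (B : Finset (Fin d →₀ ℕ)) (a : (Fin d →₀ ℕ) → ℂ) :
    polyDiff (∑ α ∈ B, monomial α (a α)) = ∑ α ∈ B, a α • partialPow α := by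
  classical
  have hcoeff : ∀ α, (∑ β ∈ B, monomial β (a β) : MvPolynomial (Fin d) ℂ).coeff α =
      if α ∈ B then a α else 0 := by
    intro α
    simp [coeff_sum, coeff_monomial]
  have hsub : (∑ β ∈ B, monomial β (a β) : MvPolynomial (Fin d) ℂ).support ⊆ B := by
    intro α hα
    rw [mem_support_iff, hcoeff] at hα
    by_contra h
    exact hα (if_neg h)
  rw [polyDiff, Finset.sum_subset hsub]
  · refine Finset.sum_congr rfl fun α hα => ?_
    rw [hcoeff, if_pos hα]
  · intro α _ hα
    rw [notMem_support_iff.1 hα, zero_smul]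

/-! ### Functionals on polynomials and their local parts -/

/-- The action of `ℂ[z]` on its dual, `(p, φ) ↦ φ(p ·)`. -/
noncomputable def dualMul (p : MvPolynomial (Fin d) ℂ) :
    Module.End ℂ (Module.Dual ℂ (MvPolynomial (Fin d) ℂ)) :=
  (LinearMap.mulLeft ℂ p).dualMap

@[simp]
theorem dualMul_apply (p q : MvPolynomial (Fin d) ℂ)
    (φ : Module.Dual ℂ (MvPolynomial (Fin d) ℂ)) : dualMul p φ q = φ (p * q) := rfl

theorem commute_dualMul (p q : MvPolynomial (Fin d) ℂ) : Commute (dualMul p) (dualMul q) := by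
  ext φ : 1
  refine LinearMap.ext fun r => ?_
  simp [mul_left_comm]

theorem dualMul_X_sub_pow_apply (i : Fin d) (c : ℂ) (k : ℕ)
    (φ : Module.Dual ℂ (MvPolynomial (Fin d) ℂ)) (p : MvPolynomial (Fin d) ℂ) :
    ((dualMul (X i) - c • (1 : Module.End ℂ (Module.Dual ℂ (MvPolynomial (Fin d) ℂ)))) ^ k) φ p = φ ((X i - C c) ^ k * p) := by
  induction k generalizing p with
  | zero => simp
  | succ k ih =>
    rw [pow_succ', Module.End.mul_apply, LinearMap.sub_apply, LinearMap.sub_apply, dualMul_apply,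
      LinearMap.smul_apply, LinearMap.smul_apply, Module.End.one_apply, ih, ih, ← map_smul,
      ← map_sub, smul_eq_C_mul]
    congr 1
    ring

/-- The functionals on `ℂ[z]` that are killed by a power of `z_i - l_i` for every `i`. -/
noncomputable def localFunctionals (l : Fin d → ℂ) :
    Submodule ℂ (Module.Dual ℂ (MvPolynomial (Fin d) ℂ)) :=
  ⨅ i, (dualMul (X i)).maxGenEigenspace (l i)

theorem mem_localFunctionals_iff {l : Fin d → ℂ}
    {φ : Module.Dual ℂ (MvPolynomial (Fin d) ℂ)} :
    φ ∈ localFunctionals l ↔ ∀ i, ∃ k : ℕ, ∀ p, φ ((X i - C (l i)) ^ k * p) = 0 := by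
  rw [localFunctionals, Module.End.mem_iInf_maxGenEigenspace_iff]
  refine forall_congr' fun i => exists_congr fun k => ?_
  rw [LinearMap.ext_iff]
  exact forall_congr' fun p => by rw [dualMul_X_sub_pow_apply]; rfl

theorem dualMul_mem_localFunctionals {l : Fin d → ℂ}
    {φ : Module.Dual ℂ (MvPolynomial (Fin d) ℂ)} (hφ : φ ∈ localFunctionals l)
    (p : MvPolynomial (Fin d) ℂ) : dualMul p φ ∈ localFunctionals l := by
  rw [mem_localFunctionals_iff] at hφ ⊢
  intro i
  obtain ⟨k, hk⟩ := hφ i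
  exact ⟨k, fun q => by rw [dualMul_apply, mul_left_comm, hk]⟩

theorem exists_eq_eval_polyDiff {l : Fin d → ℂ}
    {φ : Module.Dual ℂ (MvPolynomial (Fin d) ℂ)} (hφ : φ ∈ localFunctionals l) :
    ∃ P : MvPolynomial (Fin d) ℂ, ∀ p, φ p = eval l (polyDiff P p) := by
  classical
  rw [mem_localFunctionals_iff] at hφ
  choose k hk using hφ
  -- Outside this box a shifted monomial is divisible by some `(X i - C (l i)) ^ k i`, so `φ` kills
  -- it.
  let B : Finset (Fin d →₀ ℕ) := Finset.Iic (Finsupp.equivFunOnFinite.symm k)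
  have hB : ∀ β ∉ B, φ (shiftedMonomial l β) = 0 := by
    intro β hβ
    rw [Finset.mem_Iic, Finsupp.le_def, not_forall] at hβ
    obtain ⟨i, hi⟩ := hβ
    have hi : k i ≤ β i := (not_le.1 hi).le
    rw [shiftedMonomial, ← Finset.mul_prod_erase _ _ (Finset.mem_univ i),
      ← Nat.add_sub_cancel' hi, pow_add, mul_assoc, hk]
  -- The coefficients are forced by the duality between `∂^α / α!` at `l` and the shifted monomials.
  let a : (Fin d →₀ ℕ) → ℂ := fun α =>
    φ (shiftedMonomial l α) / ((∏ i, (α i).factorial : ℕ) : ℂ)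
  refine ⟨∑ α ∈ B, monomial α (a α), fun p => ?_⟩
  let ψ : Module.Dual ℂ (MvPolynomial (Fin d) ℂ) :=
    (aeval l).toLinearMap ∘ₗ polyDiff (∑ α ∈ B, monomial α (a α))
  suffices h : φ = ψ by
    conv_lhs => rw [h]
    simp [ψ, aeval_eq_eval]
  refine LinearMap.ext_on_range (span_range_shiftedMonomial l) fun β => ?_
  have hψ : ψ (shiftedMonomial l β) =
      ∑ α ∈ B, a α * eval l (partialPow α (shiftedMonomial l β)) := by
    simp only [ψ, polyDiff_sum_monomial, LinearMap.comp_apply, LinearMap.sum_apply,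
      LinearMap.smul_apply, map_sum, map_smul, AlgHom.toLinearMap_apply, aeval_eq_eval,
      smul_eq_mul]
  have hfact : ((∏ i, (β i).factorial : ℕ) : ℂ) ≠ 0 :=
    Nat.cast_ne_zero.2 (Finset.prod_ne_zero_iff.2 fun i _ => Nat.factorial_ne_zero _)
  simp only [hψ, eval_partialPow_shiftedMonomial, mul_ite, mul_zero, Finset.sum_ite_eq]
  split_ifs with h
  · rw [div_mul_cancel₀ _ hfact]
  · exact hB β h

/-- Commuting operators on a finite dimensional complex space decompose it into joint generalized
eigenspaces; this is applied to the coordinate multiplications restricted to `W`. -/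
theorem le_iSup_inf_localFunctionals (W : Submodule ℂ (Module.Dual ℂ (MvPolynomial (Fin d) ℂ)))
    [FiniteDimensional ℂ W] (hW : ∀ p, ∀ φ ∈ W, dualMul p φ ∈ W) :
    W ≤ ⨆ l : Fin d → ℂ, W ⊓ localFunctionals l := by
  have hmaps : ∀ i, Set.MapsTo (dualMul (X i : MvPolynomial (Fin d) ℂ)) W W :=
    fun i φ hφ => hW _ φ hφ
  have htop :=
    Module.End.iSup_iInf_maxGenEigenspace_eq_top_of_iSup_maxGenEigenspace_eq_top_of_commute
      (fun i => (dualMul (X i)).restrict (hmaps i))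
      (fun i j _ => LinearMap.ext fun φ => Subtype.ext <|
        LinearMap.congr_fun (commute_dualMul (X i) (X j)).eq φ.1)
      (fun i => Module.End.iSup_maxGenEigenspace_eq_top _)
  simp only [localFunctionals, W.inf_iInf_maxGenEigenspace_of_forall_mapsTo _ hmaps]
  rw [← Submodule.map_iSup, htop, Submodule.map_top, Submodule.range_subtype]

end MvPolynomial

/-! ### Varieties as modules of functionals -/

namespace CommHypergroup

open MvPolynomial

variable {X : Type*} [TopologicalSpace X] [T2Space X] [LocallyCompactSpace X]
  [MeasurableSpace X] [BorelSpace X] {H : CommHypergroup X}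

theorem isVariety_varietyOf (H : CommHypergroup X) (f : C(X, ℂ)) :
    H.IsVariety (H.varietyOf f) := by
  refine ⟨?_, fun g hg y => ?_⟩
  · rw [varietyOf, Submodule.coe_sInf]
    exact isClosed_biInter fun V hV => hV.1.1
  · rw [varietyOf, Submodule.mem_sInf] at hg ⊢
    exact fun V hV => hV.1.2 g (hg V hV) y

theorem mem_varietyOf (H : CommHypergroup X) (f : C(X, ℂ)) : f ∈ H.varietyOf f :=
  Submodule.mem_sInf.2 fun _ hV => hV.2

theorem varietyOf_le {V : Submodule ℂ C(X, ℂ)} (hV : H.IsVariety V) {f : C(X, ℂ)} (hf : f ∈ V) :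
    H.varietyOf f ≤ V :=
  sInf_le ⟨hV, hf⟩

namespace IsPolynomialHypergroup

variable {d : ℕ} {Q : X → MvPolynomial (Fin d) ℂ}

theorem linearIndependent_univ (hQ : H.IsPolynomialHypergroup Q) : LinearIndependent ℂ Q := by
  rw [linearIndependent_iff_finset_linearIndependent]
  intro s
  have hle : ∀ x : s, (Q x).totalDegree ≤ s.sup fun x => (Q x).totalDegree :=
    fun x => Finset.le_sup (f := fun x => (Q x).totalDegree) x.2
  exact (hQ.linearIndependent _).comp (fun x : s => ⟨x, hle x⟩)
    fun x y h => Subtype.ext (congrArg (fun z => z.1) h)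

theorem span_range_eq_top (hQ : H.IsPolynomialHypergroup Q) :
    Submodule.span ℂ (Set.range Q) = ⊤ := by
  refine eq_top_iff.2 fun p _ => ?_
  have hp : p ∈ restrictTotalDegree (Fin d) ℂ p.totalDegree :=
    (mem_restrictTotalDegree _ _ _).2 le_rfl
  rw [← hQ.span_eq] at hp
  exact Submodule.span_mono (Set.image_subset_range _ _) hp

/-- The polynomials `Q_x` as a basis of `ℂ[z_1, …, z_d]`. -/
noncomputable def basis (hQ : H.IsPolynomialHypergroup Q) :
    Module.Basis X ℂ (MvPolynomial (Fin d) ℂ) :=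
  Module.Basis.mk hQ.linearIndependent_univ hQ.span_range_eq_top.ge

@[simp]
theorem basis_apply (hQ : H.IsPolynomialHypergroup Q) (x : X) : hQ.basis x = Q x :=
  Module.Basis.mk_apply _ _ _

/-- A function `f` on `X` as the functional `Q_x ↦ f(x)` on `ℂ[z_1, …, z_d]`. -/
noncomputable def functional (hQ : H.IsPolynomialHypergroup Q) :
    C(X, ℂ) →ₗ[ℂ] Module.Dual ℂ (MvPolynomial (Fin d) ℂ) :=
  (hQ.basis.constr ℂ).toLinearMap ∘ₗ ContinuousMap.coeFnLinearMap ℂ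

@[simp]
theorem functional_apply (hQ : H.IsPolynomialHypergroup Q) (f : C(X, ℂ)) (x : X) :
    hQ.functional f (Q x) = f x := by
  rw [← hQ.basis_apply x]
  exact hQ.basis.constr_basis ℂ _ x

theorem functional_injective (hQ : H.IsPolynomialHypergroup Q) :
    Function.Injective hQ.functional := fun f g h => by
  ext x
  rw [← hQ.functional_apply f, h, hQ.functional_apply]

theorem functional_translate (hQ : H.IsPolynomialHypergroup Q) (y : X) (f : C(X, ℂ)) :
    hQ.functional (H.translate y f) = dualMul (Q y) (hQ.functional f) := by
  refine hQ.basis.ext fun x => ?_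
  obtain ⟨c, hc, hconv⟩ := hQ.linearization x y
  rw [hQ.basis_apply, functional_apply, dualMul_apply, mul_comm, hc]
  change ∫ t, f t ∂(H.conv x y : Measure X) = _
  have hint : ∀ w, Integrable f (c w • Measure.dirac w) := fun w =>
    (integrable_dirac (by finiteness)).smul_measure_nnreal
  rw [hconv, Finsupp.sum, integral_finsetSum_measure fun w _ => hint w, Finsupp.sum, map_sum]
  refine Finset.sum_congr rfl fun w _ => ?_
  rw [integral_smul_nnreal_measure, integral_dirac, map_smul, functional_apply]
  rfl

/-- Translations give the action of the `Q y`, and these span `ℂ[z]`. -/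
theorem dualMul_mem_map_functional (hQ : H.IsPolynomialHypergroup Q) {V : Submodule ℂ C(X, ℂ)}
    (hV : ∀ f ∈ V, ∀ y, H.translate y f ∈ V) (p : MvPolynomial (Fin d) ℂ)
    {φ : Module.Dual ℂ (MvPolynomial (Fin d) ℂ)} (hφ : φ ∈ V.map hQ.functional) :
    dualMul p φ ∈ V.map hQ.functional := by
  have hp : p ∈ Submodule.span ℂ (Set.range Q) := hQ.span_range_eq_top ▸ Submodule.mem_top
  induction hp using Submodule.span_induction with
  | mem p hp =>
    obtain ⟨y, rfl⟩ := hp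
    obtain ⟨f, hf, rfl⟩ := hφ
    exact ⟨_, hV f hf y, hQ.functional_translate y f⟩
  | zero =>
    have : dualMul (0 : MvPolynomial (Fin d) ℂ) φ = 0 := LinearMap.ext fun q => by simp
    exact this ▸ Submodule.zero_mem _
  | add p q _ _ hp hq =>
    have : dualMul (p + q) φ = dualMul p φ + dualMul q φ :=
      LinearMap.ext fun r => by simp [add_mul]
    exact this ▸ Submodule.add_mem _ hp hq
  | smul a p _ hp =>
    have : dualMul (a • p) φ = a • dualMul p φ := LinearMap.ext fun r => by simp
    exact this ▸ Submodule.smul_mem _ a hp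

/-- The functions on `X` whose functional is killed by a power of `z_i - l_i` for every `i`. -/
noncomputable def localFunctions (hQ : H.IsPolynomialHypergroup Q) (l : Fin d → ℂ) :
    Submodule ℂ C(X, ℂ) :=
  (localFunctionals l).comap hQ.functional

theorem exists_eq_eval_polyDiff (hQ : H.IsPolynomialHypergroup Q) {l : Fin d → ℂ} {f : C(X, ℂ)}
    (hf : f ∈ hQ.localFunctions l) :
    ∃ P : MvPolynomial (Fin d) ℂ, ∀ x, f x = eval l (polyDiff P (Q x)) := by
  obtain ⟨P, hP⟩ := MvPolynomial.exists_eq_eval_polyDiff (Submodule.mem_comap.1 hf)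
  exact ⟨P, fun x => by rw [← hP, functional_apply]⟩

theorem translate_mem_localFunctions (hQ : H.IsPolynomialHypergroup Q) {l : Fin d → ℂ}
    {f : C(X, ℂ)} (hf : f ∈ hQ.localFunctions l) (y : X) :
    H.translate y f ∈ hQ.localFunctions l := by
  rw [localFunctions, Submodule.mem_comap, functional_translate]
  exact dualMul_mem_localFunctionals hf _

/-- The elements of a translation invariant finite dimensional space are sums of elements of that
space that are local at points of `ℂ^d`. -/
theorem exists_eq_sum_localFunctions (hQ : H.IsPolynomialHypergroup Q)
    {V : Submodule ℂ C(X, ℂ)} [FiniteDimensional ℂ V]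
    (hV : ∀ f ∈ V, ∀ y, H.translate y f ∈ V) {f : C(X, ℂ)} (hf : f ∈ V) :
    ∃ (S : Finset (Fin d → ℂ)) (g : (Fin d → ℂ) → C(X, ℂ)),
      (∀ l, g l ∈ V ⊓ hQ.localFunctions l) ∧ f = ∑ l ∈ S, g l := by
  have hmem := le_iSup_inf_localFunctionals (V.map hQ.functional)
    (fun p _ hφ => hQ.dualMul_mem_map_functional hV p hφ) (Submodule.mem_map_of_mem hf)
  rw [Submodule.mem_iSup_iff_exists_finsupp] at hmem
  obtain ⟨w, hw, hsum⟩ := hmem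
  have hpre : ∀ l, ∃ g ∈ V, hQ.functional g = w l := fun l => (hw l).1
  choose g hgV hg using hpre
  refine ⟨w.support, g, fun l => ⟨hgV l, ?_⟩, hQ.functional_injective ?_⟩
  · rw [SetLike.mem_coe, localFunctions, Submodule.mem_comap, hg]
    exact (hw l).2
  · rw [map_sum, ← hsum]
    exact Finset.sum_congr rfl fun l _ => (hg l).symm

theorem isVariety_sup_inf_localFunctions (hQ : H.IsPolynomialHypergroup Q)
    {V : Submodule ℂ C(X, ℂ)} [FiniteDimensional ℂ V]
    (hV : ∀ f ∈ V, ∀ y, H.translate y f ∈ V) (S : Finset (Fin d → ℂ)) :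
    H.IsVariety (S.sup fun l => V ⊓ hQ.localFunctions l) := by
  have hle : (S.sup fun l => V ⊓ hQ.localFunctions l) ≤ V :=
    Finset.sup_le fun _ _ => inf_le_left
  have := Submodule.finiteDimensional_of_le hle
  refine ⟨Submodule.closed_of_finiteDimensional _, fun f hf y => ?_⟩
  rw [Finset.sup_eq_iSup, Submodule.mem_iSup_finset_iff_exists_sum] at hf
  obtain ⟨g, rfl⟩ := hf
  -- Passing to functionals replaces translation by the linear map `dualMul (Q y)`, which
  -- distributes over the sum.
  refine hQ.functional_injective.mem_set_image.1 ?_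
  rw [functional_translate, map_sum, map_sum]
  refine Submodule.sum_mem (Submodule.map hQ.functional _) fun l hl => ?_
  rw [← functional_translate]
  exact Submodule.mem_map_of_mem (Finset.le_sup (f := fun l => V ⊓ hQ.localFunctions l) hl
    ⟨hV _ (g l).2.1 y, hQ.translate_mem_localFunctions (g l).2.2 y⟩)

/-- An indecomposable finite dimensional variety that is a sum of local parts is local. -/
theorem exists_le_localFunctions (hQ : H.IsPolynomialHypergroup Q)
    {V : Submodule ℂ C(X, ℂ)} [FiniteDimensional ℂ V] (hV : H.IsVariety V)
    (hind : ¬ ∃ V₁ V₂ : Submodule ℂ C(X, ℂ), H.IsVariety V₁ ∧ H.IsVariety V₂ ∧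
      V₁ < V ∧ V₂ < V ∧ V₁ ⊔ V₂ = V)
    (S : Finset (Fin d → ℂ)) (hS : (S.sup fun l => V ⊓ hQ.localFunctions l) = V) :
    ∃ l, V ≤ hQ.localFunctions l := by
  induction S using Finset.induction_on with
  | empty => exact ⟨0, hS ▸ bot_le⟩
  | insert l S _ ih =>
    by_contra! h
    -- If `V` lies in no local space, its part at `l` is proper, and so is the sum over `S` by the
    -- induction hypothesis; together they would decompose `V`.
    refine hind ⟨_, _, ?_, hQ.isVariety_sup_inf_localFunctions hV.2 S, inf_lt_left.2 (h l),
      lt_of_le_of_ne (Finset.sup_le fun _ _ => inf_le_left) fun hS' => ?_, ?_⟩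
    · simpa using hQ.isVariety_sup_inf_localFunctions hV.2 {l}
    · obtain ⟨l', hl'⟩ := ih hS'
      exact h l' hl'
    · rwa [Finset.sup_insert] at hS

end IsPolynomialHypergroup

end CommHypergroup

theorem corollary5p4 {X : Type*} [TopologicalSpace X] [T2Space X] [LocallyCompactSpace X]
    [MeasurableSpace X] [BorelSpace X] {d : ℕ} (hd : 0 < d)
    (H : CommHypergroup X) (Q : X → MvPolynomial (Fin d) ℂ) (hQ : H.IsPolynomialHypergroup Q) :
    (∀ f : C(X, ℂ), H.IsExponentialMonomial f →
      ∃ (P : MvPolynomial (Fin d) ℂ) (l : Fin d → ℂ),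
        ∀ x, f x = MvPolynomial.eval l (polyDiff P (Q x))) ∧
    (∀ f : C(X, ℂ), H.IsExponentialPolynomial f →
      ∃ (S : Finset (Fin d → ℂ)) (P : (Fin d → ℂ) → MvPolynomial (Fin d) ℂ),
        ∀ x, f x = ∑ l ∈ S, MvPolynomial.eval l (polyDiff (P l) (Q x))) := by
  refine ⟨fun f hf => ?_, fun f hf => ?_⟩
  · have hfin : FiniteDimensional ℂ (H.varietyOf f) := hf.1
    have hvar := H.isVariety_varietyOf f
    obtain ⟨S, g, hg, hsum⟩ := hQ.exists_eq_sum_localFunctions hvar.2 (H.mem_varietyOf f)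
    -- The finite sum of local parts is a variety containing `f`, hence all of `H.varietyOf f` by
    -- minimality.
    have hS : (S.sup fun l => H.varietyOf f ⊓ hQ.localFunctions l) = H.varietyOf f := by
      refine le_antisymm (Finset.sup_le fun _ _ => inf_le_left)
        (CommHypergroup.varietyOf_le (hQ.isVariety_sup_inf_localFunctions hvar.2 S) ?_)
      conv_rhs => rw [hsum]
      exact Submodule.sum_mem _ fun l hl =>
        Finset.le_sup (f := fun l => H.varietyOf f ⊓ hQ.localFunctions l) hl (hg l)
    obtain ⟨l, hl⟩ := hQ.exists_le_localFunctions hvar hf.2 S hS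
    obtain ⟨P, hP⟩ := hQ.exists_eq_eval_polyDiff (hl (H.mem_varietyOf f))
    exact ⟨P, l, hP⟩
  · have hfin : FiniteDimensional ℂ (H.varietyOf f) := hf
    obtain ⟨S, g, hg, hsum⟩ :=
      hQ.exists_eq_sum_localFunctions (H.isVariety_varietyOf f).2 (H.mem_varietyOf f)
    choose P hP using fun l => hQ.exists_eq_eval_polyDiff (hg l).2
    refine ⟨S, P, fun x => ?_⟩
    rw [hsum, ContinuousMap.sum_apply]
    exact Finset.sum_congr rfl fun l _ => hP l x
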